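/- Let $N,d$ be non-negative integers, let $\mathbb F_+^d$ be the free monoid on $d$ symbols with unit the empty word, and let $*$ be the coordinatewise multiplication of the monoid $(\mathbb F_+^d)^N$, with unit $\underline\emptyset=(\emptyset,\dots,\emptyset)$. For $i\in[N]=\{1,\dots,N\}$ and $k\in[d]$ let $\delta_i(k)$ be the element with the letter $k$ at coordinate $i$ and empty words elsewhere. Let $\Lambda^*\subseteq(\mathbb F_+^d)^N$ be a factorial language: for every $i\in[N]$ there is some $k\in[d]$ with $\delta_i(k)\in\Lambda^*$, and $w*\nu*q\in\Lambda^*$ implies $\nu\in\Lambda^*$. On $\ell^2(\Lambda^*)$, with canonical basis $(e_w)_{w\in\Lambda^*}$, let $T_\mu e_w=e_{\mu*w}$ if $\mu*w\in\Lambda^*$ and $T_\mu e_w=0$ otherwise. Let $A\subseteq\mathcal B(\ell^2(\Lambda^*))$ be the unital C*-algebra generated by the projections $T_\mu^*T_\mu$, $\mu\in\Lambda^*$. For $i\in[N]$ let $X_i$ be the C*-correspondence over $A$ given by $$X_i=\overline{\operatorname{span}}\{T_{\delta_i(k)}a : a\in A,\ k\in[d],\ \delta_i(k)\in\Lambda^*\}\subseteq\mathcal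 B(\ell^2(\Lambda^*)),$$ with inner product $\langle\xi,\eta\rangle=\xi^*\eta$, right action by multiplication, and left action $\phi_i(a)\xi=a\xi$. Put $P_i=\sum_{k\in[d]}T_{\delta_i(k)}T_{\delta_i(k)}^*$ and, for $G\subseteq[N]$, $Q_G=\prod_{i\in G}(I-P_i)$ (commuting factors, with the empty product equal to $I$). Let $Q_{\underline\emptyset}$ be the orthogonal projection onto $\mathbb C e_{\underline\emptyset}$. Let $\emptyset\ne F\subseteq[N]$ and $F^c=[N]\setminus F$. Then the following are equivalent: (i) there exists $a\in\bigcap_{i\in F}\ker\phi_i$ such that $aQ_{F^c}\neq0$; (ii) there exists $a\in A$ such that $aQ_{F^c}=Q_{\underline\emptyset}$; (iii) for every $\delta_i(k)\in\Lambda^*$ with $(i,k)\in F\times[d]$ there exists $\mu\in\Lambda^*$ such that $\mu*\delta_i(k)\notin\Lambda^*$. If $F=[N]$, then (iii) is equivalent to each of: (iv) $\bigcap_{i\in[N]}\ker\phi_i=\mathbb C Q_{\underline\emptyset}$; (v) $\bigcap_{i\in[N]}\ker\phi_i\neq(0)$; (vi) $Q_{\underline\emptyset}\in A$. -/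

import Mathlib

noncomputable section

/-- The monoid `(𝔽₊^d)^N`: `N`-tuples of words on `d` symbols, with coordinatewise concatenation. -/
abbrev MultiWord (N d : ℕ) : Type := Fin N → FreeMonoid (Fin d)

/-- The generator `δ_i(k)`: the letter `k` in coordinate `i`, the empty word elsewhere. -/
def MultiWord.delta {N d : ℕ} (i : Fin N) (k : Fin d) : MultiWord N d :=
  Pi.mulSingle i (FreeMonoid.of k)

/-- `ν ∈ μ`: `ν` is a subword of `μ`. -/
def MultiWord.IsSubword {N d : ℕ} (ν μ : MultiWord N d) : Prop :=
  ∃ w q : MultiWord N d, μ = w * ν * q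

/-- A (higher rank) factorial language in `(𝔽₊^d)^N`. -/
structure FactorialLanguage (N d : ℕ) where
  /-- the set of allowed words -/
  words : Set (MultiWord N d)
  exists_delta_mem : ∀ i : Fin N, ∃ k : Fin d, MultiWord.delta i k ∈ words
  subword_mem : ∀ μ ∈ words, ∀ ν : MultiWord N d, MultiWord.IsSubword ν μ → ν ∈ words

namespace FactorialLanguage

variable {N d : ℕ} (Λ : FactorialLanguage N d)

/-- The Hilbert space `ℓ²(Λ*)`. -/
abbrev H : Type := lp (fun _ : Λ.words => ℂ) 2

/-- The algebra `𝓑(ℓ²(Λ*))` of bounded operators. -/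
abbrev B : Type := Λ.H →L[ℂ] Λ.H

open Classical in
/-- The canonical basis vector `e_w` for `w ∈ Λ*`, and `0` for `w ∉ Λ*`. -/
def e (w : MultiWord N d) : Λ.H :=
  if h : w ∈ Λ.words then lp.single 2 (⟨w, h⟩ : Λ.words) (1 : ℂ) else 0

open Classical in
/-- The coordinates of the vector `T_μ^* f`. -/
def pullFun (μ : MultiWord N d) (f : Λ.words → ℂ) (w : Λ.words) : ℂ :=
  if h : μ * (w : MultiWord N d) ∈ Λ.words then f ⟨μ * w, h⟩ else 0

theorem sum_pullFun_le (μ : MultiWord N d) (f : Λ.H) (s : Finset Λ.words) :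
    ∑ w ∈ s, ‖Λ.pullFun μ f w‖ ^ (2 : ENNReal).toReal ≤ ‖f‖ ^ (2 : ENNReal).toReal := by
  classical
  have hp : 0 < (2 : ENNReal).toReal := by norm_num
  let t : Finset Λ.words := s.filter (fun w => μ * (w : MultiWord N d) ∈ Λ.words)
  let g : Λ.words → Λ.words := fun w =>
    if h : μ * (w : MultiWord N d) ∈ Λ.words then ⟨μ * w, h⟩ else w
  have h1 : ∑ w ∈ s, ‖Λ.pullFun μ f w‖ ^ (2 : ENNReal).toReal
      = ∑ w ∈ t, ‖f (g w)‖ ^ (2 : ENNReal).toReal := by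
    rw [Finset.sum_filter]
    refine Finset.sum_congr rfl fun w _ => ?_
    by_cases h : μ * (w : MultiWord N d) ∈ Λ.words
    · simp [pullFun, g, h]
    · simp [pullFun, h]
  have hinj : Set.InjOn g t := by
    intro a ha b hb hab
    have ha' := (Finset.mem_filter.1 ha).2
    have hb' := (Finset.mem_filter.1 hb).2
    simp only [g, dif_pos ha', dif_pos hb', Subtype.mk.injEq] at hab
    exact Subtype.ext (mul_left_cancel hab)
  rw [h1, ← Finset.sum_image (f := fun u => ‖f u‖ ^ (2 : ENNReal).toReal) hinj]
  exact lp.sum_rpow_le_norm_rpow hp f _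

/-- The operator `e_u ↦ e_w` if `u = μ * w` with `w ∈ Λ*`, and `e_u ↦ 0` if there is no such
`w`; this is `T_μ^*`. -/
def pull (μ : MultiWord N d) : Λ.B :=
  LinearMap.mkContinuous
    { toFun := fun f => ⟨Λ.pullFun μ f, memℓp_gen' (Λ.sum_pullFun_le μ f)⟩
      map_add' := by
        intro f g
        ext w
        change Λ.pullFun μ (f + g) w = Λ.pullFun μ f w + Λ.pullFun μ g w
        by_cases h : μ * (w : MultiWord N d) ∈ Λ.words <;> simp [pullFun, h]
      map_smul' := by
        intro c f
        ext w
        by_cases h : μ * (w : MultiWord N d) ∈ Λ.words <;> simp [pullFun, h] }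
    1 (by
      intro f
      rw [one_mul]
      exact lp.norm_le_of_forall_sum_le (by norm_num) (norm_nonneg f) (Λ.sum_pullFun_le μ f))

/-- The operator `T_μ` on `ℓ²(Λ*)`, with `T_μ e_w = e_{μ * w}` if `μ * w ∈ Λ*` and `T_μ e_w = 0`
otherwise (proved in `T_e` below). -/
def T (μ : MultiWord N d) : Λ.B := ContinuousLinearMap.adjoint (Λ.pull μ)

theorem star_T (μ : MultiWord N d) : star (Λ.T μ) = Λ.pull μ := by
  simp [T, ContinuousLinearMap.star_eq_adjoint]

theorem pull_apply (μ : MultiWord N d) (f : Λ.H) (w : Λ.words) :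
    Λ.pull μ f w = Λ.pullFun μ f w := rfl

theorem inner_e {w : MultiWord N d} (hw : w ∈ Λ.words) (f : Λ.H) :
    inner ℂ (Λ.e w) f = f ⟨w, hw⟩ := by
  classical
  rw [e, dif_pos hw, lp.inner_single_left]
  simp

theorem ext_inner_e {f g : Λ.H}
    (h : ∀ w ∈ Λ.words, inner ℂ (Λ.e w) f = inner ℂ (Λ.e w) g) : f = g := by
  ext w
  have := h w w.2
  rwa [inner_e _ w.2, inner_e _ w.2] at this

theorem e_apply (w : MultiWord N d) (u : Λ.words) [Decidable ((u : MultiWord N d) = w)] :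
    Λ.e w u = if (u : MultiWord N d) = w then 1 else 0 := by
  classical
  by_cases hw : w ∈ Λ.words
  · rw [e, dif_pos hw, lp.single_apply]
    by_cases h : (u : MultiWord N d) = w
    · have : u = ⟨w, hw⟩ := Subtype.ext h
      subst this
      simp
    · have : u ≠ ⟨w, hw⟩ := fun h' => h (congrArg Subtype.val h')
      simp [h, this]
  · have : (u : MultiWord N d) ≠ w := fun h' => hw (h' ▸ u.2)
    rw [e, dif_neg hw]
    simp [this]

/-- The defining formula of `T_μ` (recall that `e v = 0` for `v ∉ Λ*`). -/
theorem T_e (μ : MultiWord N d) {w : MultiWord N d} (hw : w ∈ Λ.words) :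
    Λ.T μ (Λ.e w) = Λ.e (μ * w) := by
  classical
  refine Λ.ext_inner_e fun u hu => ?_
  rw [T, ContinuousLinearMap.adjoint_inner_right, ← inner_conj_symm, Λ.inner_e hw,
    Λ.inner_e hu, pull_apply, e_apply, pullFun]
  by_cases h : μ * w ∈ Λ.words
  · rw [dif_pos h, e_apply]
    by_cases h' : u = μ * w
    · simp [h']
    · simp [h', Ne.symm h']
  · have : u ≠ μ * w := fun h' => h (h' ▸ hu)
    simp [h, this]

theorem mem_of_mul_mem_left {u v : MultiWord N d} (h : u * v ∈ Λ.words) : u ∈ Λ.words :=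
  Λ.subword_mem _ h u ⟨1, v, by simp⟩

theorem T_eq_zero {μ : MultiWord N d} (h : μ ∉ Λ.words) : Λ.T μ = 0 := by
  have : Λ.pull μ = 0 := by
    ext f w
    have hw : μ * (w : MultiWord N d) ∉ Λ.words := fun h' => h (Λ.mem_of_mul_mem_left h')
    rw [pull_apply, pullFun, dif_neg hw]
    simp
  simp [T, this]

theorem T_mul (μ ν : MultiWord N d) : Λ.T (μ * ν) = Λ.T μ * Λ.T ν := by
  have : Λ.pull (μ * ν) = Λ.pull ν * Λ.pull μ := by
    ext f w
    change Λ.pullFun (μ * ν) f w = Λ.pullFun ν (Λ.pull μ f) w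
    by_cases h : μ * (ν * (w : MultiWord N d)) ∈ Λ.words
    · have h' : ν * (w : MultiWord N d) ∈ Λ.words :=
        Λ.subword_mem _ h _ ⟨μ, 1, by simp⟩
      have h'' : μ * ν * (w : MultiWord N d) ∈ Λ.words := by rwa [mul_assoc]
      rw [pullFun, dif_pos h'', pullFun, dif_pos h', pull_apply, pullFun, dif_pos h]
      simp only [mul_assoc]
    · have h'' : μ * ν * (w : MultiWord N d) ∉ Λ.words := by rwa [mul_assoc]
      rw [pullFun, dif_neg h'', pullFun]
      split_ifs with h'
      · rw [pull_apply, pullFun, dif_neg h]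
      · rfl
  rw [← star_inj, star_mul]
  simp only [star_T, this]

/-- The C*-algebra of checkers: the unital C*-subalgebra `A` of `𝓑(ℓ²(Λ*))` generated by the
projections `T_μ^* T_μ`, `μ ∈ Λ*`. -/
def A : StarSubalgebra ℂ Λ.B :=
  (StarAlgebra.adjoin ℂ {p : Λ.B | ∃ μ ∈ Λ.words, p = star (Λ.T μ) * Λ.T μ}).topologicalClosure

/-- The closed linear span `X_i(Λ*)` of the operators `T_{δ_i(k)} a` with `δ_i(k) ∈ Λ*`, `a ∈ A`. -/
def X (i : Fin N) : Submodule ℂ Λ.B :=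
  (Submodule.span ℂ {ξ : Λ.B | ∃ k : Fin d, MultiWord.delta i k ∈ Λ.words ∧
    ∃ a ∈ Λ.A, ξ = Λ.T (MultiWord.delta i k) * a}).topologicalClosure

theorem gen_mul_T (μ ν : MultiWord N d) :
    (star (Λ.T μ) * Λ.T μ) * Λ.T ν = Λ.T ν * (star (Λ.T (μ * ν)) * Λ.T (μ * ν)) := by
  classical
  have key : star (Λ.T ν) * (star (Λ.T μ) * Λ.T μ)
      = (star (Λ.T (μ * ν)) * Λ.T (μ * ν)) * star (Λ.T ν) := by
    have hp : ∀ (κ : MultiWord N d) (f : Λ.H) (w : Λ.words),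
        (star (Λ.T κ) * Λ.T κ) f w = if κ * (w : MultiWord N d) ∈ Λ.words then f w else 0 := by
      intro κ f w
      rw [mul_apply_eq_comp, star_T, pull_apply, pullFun]
      split_ifs with h
      · rw [← Λ.inner_e h, T, ContinuousLinearMap.adjoint_inner_right]
        have : Λ.pull κ (Λ.e (κ * w)) = Λ.e w := by
          ext v
          rw [pull_apply, pullFun, e_apply]
          by_cases hv : (v : MultiWord N d) = w
          · simp [hv, h, e_apply]
          · simp [hv, e_apply]
        rw [this, Λ.inner_e w.2]
      · rfl
    ext f w
    rw [mul_apply_eq_comp, mul_apply_eq_comp (star (Λ.T (μ * ν)) * _),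
      hp, star_T, pull_apply, pull_apply]
    by_cases h : ν * (w : MultiWord N d) ∈ Λ.words
    · rw [pullFun, dif_pos h, hp, pullFun, dif_pos h]
      simp only [mul_assoc]
    · simp [pullFun, h]
  have := congrArg star key
  simpa [mul_assoc] using this

theorem gen_mem_A (μ : MultiWord N d) : star (Λ.T μ) * Λ.T μ ∈ Λ.A := by
  by_cases h : μ ∈ Λ.words
  · exact StarSubalgebra.le_topologicalClosure _
      (StarAlgebra.subset_adjoin ℂ _ ⟨μ, h, rfl⟩)
  · rw [Λ.T_eq_zero h, mul_zero]
    exact zero_mem _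

/-- `X_i(Λ*)` is invariant under left multiplication by `A`. -/
theorem mul_mem_X (i : Fin N) {a ξ : Λ.B} (ha : a ∈ Λ.A) (hξ : ξ ∈ Λ.X i) : a * ξ ∈ Λ.X i := by
  have hX : IsClosed (Λ.X i : Set Λ.B) := Submodule.isClosed_topologicalClosure _
  have hexch : ∀ (ν : MultiWord N d) (b : Λ.B),
      b ∈ StarAlgebra.adjoin ℂ {p : Λ.B | ∃ μ ∈ Λ.words, p = star (Λ.T μ) * Λ.T μ} →
      ∃ c ∈ Λ.A, b * Λ.T ν = Λ.T ν * c ∧ star b * Λ.T ν = Λ.T ν * star c := by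
    intro ν b hb
    induction hb using StarAlgebra.adjoin_induction with
    | mem x hx =>
      obtain ⟨μ, -, rfl⟩ := hx
      refine ⟨_, Λ.gen_mem_A (μ * ν), Λ.gen_mul_T μ ν, ?_⟩
      simpa using Λ.gen_mul_T μ ν
    | algebraMap r =>
      refine ⟨algebraMap ℂ _ r, StarSubalgebra.algebraMap_mem _ r, Algebra.commutes _ _, ?_⟩
      rw [← algebraMap_star_comm]
      exact Algebra.commutes _ _
    | add x y hx hy ihx ihy =>
      obtain ⟨c, hc, h1, h2⟩ := ihx
      obtain ⟨c', hc', h1', h2'⟩ := ihy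
      exact ⟨c + c', add_mem hc hc', by rw [add_mul, mul_add, h1, h1'],
        by rw [star_add, star_add, add_mul, mul_add, h2, h2']⟩
    | mul x y hx hy ihx ihy =>
      obtain ⟨c, hc, h1, h2⟩ := ihx
      obtain ⟨c', hc', h1', h2'⟩ := ihy
      exact ⟨c * c', mul_mem hc hc', by rw [mul_assoc, h1', ← mul_assoc, h1, mul_assoc],
        by rw [star_mul, star_mul, mul_assoc, h2, ← mul_assoc, h2', mul_assoc]⟩
    | star x hx ihx =>
      obtain ⟨c, hc, h1, h2⟩ := ihx
      exact ⟨star c, star_mem hc, h2, by rw [star_star, star_star, h1]⟩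
  have h1 : ∀ b ∈ StarAlgebra.adjoin ℂ {p : Λ.B | ∃ μ ∈ Λ.words, p = star (Λ.T μ) * Λ.T μ},
      ∀ η ∈ Λ.X i, b * η ∈ Λ.X i := by
    intro b hb η hη
    have hcl : IsClosed {η : Λ.B | b * η ∈ Λ.X i} :=
      hX.preimage (continuous_const.mul continuous_id)
    refine closure_minimal (t := {η : Λ.B | b * η ∈ Λ.X i}) ?_ hcl hη
    intro ζ hζ
    induction hζ using Submodule.span_induction with
    | mem x hx =>
      obtain ⟨k, hk, a', ha', rfl⟩ := hx
      obtain ⟨c, hc, hbc, -⟩ := hexch (MultiWord.delta i k) b hb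
      refine Submodule.le_topologicalClosure _ (Submodule.subset_span ⟨k, hk, c * a',
        mul_mem hc ha', ?_⟩)
      rw [← mul_assoc, hbc, mul_assoc]
    | zero => simp
    | add x y _ _ hx hy =>
      simp only [Set.mem_ofPred_eq, mul_add]
      exact add_mem hx hy
    | smul r x _ hx =>
      simp only [Set.mem_ofPred_eq, mul_smul_comm]
      exact Submodule.smul_mem _ r hx
  have hcl : IsClosed {b : Λ.B | b * ξ ∈ Λ.X i} :=
    hX.preimage (continuous_id.mul continuous_const)
  exact closure_minimal (t := {b : Λ.B | b * ξ ∈ Λ.X i}) (fun b hb => h1 b hb ξ hξ) hcl ha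

/-- The left action `φ_i` of `A` on the C*-correspondence `X_i(Λ*)`, that is, `φ_i(a) ξ = a ξ`.
(With respect to the `A`-valued inner product `⟨ξ, η⟩ = ξ^* η`, the operator `φ_i(a)` is
adjointable with adjoint `φ_i(a^*)`; here it is recorded as a bounded operator on `X_i(Λ*)`.) -/
def phi (i : Fin N) : Λ.A →ₐ[ℂ] (Λ.X i →L[ℂ] Λ.X i) where
  toFun a :=
    ((ContinuousLinearMap.mul ℂ Λ.B (a : Λ.B)).comp (Λ.X i).subtypeL).codRestrict (Λ.X i)
      (fun ξ => Λ.mul_mem_X i a.2 ξ.2)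
  map_one' := by
    refine ContinuousLinearMap.ext fun ξ => Subtype.ext ?_
    exact one_mul (ξ : Λ.B)
  map_mul' a b := by
    refine ContinuousLinearMap.ext fun ξ => Subtype.ext ?_
    exact mul_assoc (a : Λ.B) (b : Λ.B) (ξ : Λ.B)
  map_zero' := by
    refine ContinuousLinearMap.ext fun ξ => Subtype.ext ?_
    exact zero_mul (ξ : Λ.B)
  map_add' a b := by
    refine ContinuousLinearMap.ext fun ξ => Subtype.ext ?_
    exact add_mul (a : Λ.B) (b : Λ.B) (ξ : Λ.B)
  commutes' r := by
    refine ContinuousLinearMap.ext fun ξ => Subtype.ext ?_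
    exact (Algebra.smul_def r (ξ : Λ.B)).symm

theorem coe_phi_apply (i : Fin N) (a : Λ.A) (ξ : Λ.X i) :
    (Λ.phi i a ξ : Λ.B) = (a : Λ.B) * (ξ : Λ.B) := rfl

/-- The ideal `⋂_{i ∈ F} ker φ_i` of `A`. -/
def kerPhi (F : Finset (Fin N)) : Ideal Λ.A := ⨅ i ∈ F, RingHom.ker (Λ.phi i)

/-- `P_i = ∑_k T_{δ_i(k)} T_{δ_i(k)}^*`. -/
def P (i : Fin N) : Λ.B :=
  ∑ k : Fin d, Λ.T (MultiWord.delta i k) * star (Λ.T (MultiWord.delta i k))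

/-- `Q_F = ∏_{i ∈ F} (I - P_i)`, the (commuting) factors being listed in increasing order of `i`;
for `F = ∅` it is the identity. -/
def Q (F : Finset (Fin N)) : Λ.B :=
  ((F.sort (· ≤ ·)).map (fun i => 1 - Λ.P i)).prod

/-- The orthogonal projection of `ℓ²(Λ*)` onto the line spanned by `e_∅`, where `∅` is the
empty multi-word (the unit of the monoid). -/
def QEmptyWord : Λ.B := (Submodule.span ℂ {Λ.e 1}).starProjection

end FactorialLanguage

end

/-! Every element of `A` is diagonal in the basis `e_w`: the generator `T_μ^* T_μ` has entry 1 at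
`w` when `μ * w` is allowed and 0 otherwise, and being diagonal survives algebraic operations,
adjoints and norm limits. All the conditions thus become statements about entries.

An element of `A` lies in `ker φ_i` exactly when its entries vanish at all words with nonempty
coordinate `i` (`mem_ker_phi_iff`), and `Q_{F^c}` keeps the words supported on `F` (`Q_apply`). So
for `a` in the intersection of the kernels over `F`, the product `a Q_{F^c}` is the entry of `a` at
the empty word times `Q_∅` (`mul_Q_eq_smul_QEmptyWord`).

If no left prolongation of `δ_i(k)` by an allowed word is forbidden, all generators have entry 1
both at the empty word and at `δ_i(k)`, hence the two entries agree throughout `A`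
(`A_le_diagonalEq`), which contradicts (i) and (ii). Conversely, a finite product of generators, one
for each allowed `δ_i(k)` with `i ∈ F`, has entry 1 at the empty word and lies in the kernels
(`exists_mem_kerPhi`). -/

namespace MultiWord

variable {N d : ℕ}

/-! ### First letters in a given coordinate. -/

theorem delta_mul_apply_ne_one (i : Fin N) (k : Fin d) (v : MultiWord N d) :
    (delta i k * v) i ≠ 1 := by
  rw [Pi.mul_apply, delta, Pi.mulSingle_eq_same]
  intro h
  have := congrArg FreeMonoid.length h
  simp at this

theorem delta_mul_inj {i : Fin N} {k l : Fin d} {v w : MultiWord N d}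
    (h : delta i k * v = delta i l * w) : k = l := by
  have := congrArg FreeMonoid.toList (congrFun h i)
  simp only [Pi.mul_apply, delta, Pi.mulSingle_eq_same, FreeMonoid.toList_of_mul] at this
  exact (List.cons.inj this).1

theorem exists_eq_delta_mul {i : Fin N} {w : MultiWord N d} (h : w i ≠ 1) :
    ∃ k v, w = delta i k * v := by
  cases hw : w i using FreeMonoid.casesOn with
  | one => exact absurd hw h
  | of_mul k t =>
    -- Drop the first letter of coordinate `i` and leave the other coordinates alone.
    refine ⟨k, Function.update w i t, ?_⟩
    ext1 j
    by_cases hj : j = i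
    · subst hj
      simp [delta, hw]
    · simp [delta, hj]

end MultiWord

/-! ### Diagonal operators and their entries. -/

namespace FactorialLanguage

open MultiWord

variable {N d : ℕ} (Λ : FactorialLanguage N d)

theorem mem_of_mul_mem_right {u v : MultiWord N d} (h : u * v ∈ Λ.words) : v ∈ Λ.words :=
  Λ.subword_mem _ h v ⟨u, 1, by simp⟩

theorem one_mem_words (i : Fin N) : (1 : MultiWord N d) ∈ Λ.words := by
  obtain ⟨k, hk⟩ := Λ.exists_delta_mem i
  exact Λ.subword_mem _ hk 1 ⟨1, MultiWord.delta i k, by simp⟩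

/-- The diagonal entry of the operator `b` at the basis vector `e_w`. -/
noncomputable def diagCoeff (b : Λ.B) (w : Λ.words) : ℂ := b (Λ.e w) w

theorem e_self (w : Λ.words) : Λ.e w w = 1 := by
  classical
  simp [e_apply]

/-- `b` is diagonal with respect to the canonical basis. -/
def IsDiagonal (b : Λ.B) : Prop := ∀ (f : Λ.H) (w : Λ.words), b f w = Λ.diagCoeff b w * f w

variable {Λ}

theorem diagCoeff_eq {b : Λ.B} {c : Λ.words → ℂ} (h : ∀ f w, b f w = c w * f w) (w : Λ.words) :
    Λ.diagCoeff b w = c w := by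
  rw [diagCoeff, h, e_self, mul_one]

theorem isDiagonal_of_forall {b : Λ.B} {c : Λ.words → ℂ} (h : ∀ f w, b f w = c w * f w) :
    Λ.IsDiagonal b := fun f w => by rw [diagCoeff_eq h, h]

theorem IsDiagonal.apply_e {b : Λ.B} (hb : Λ.IsDiagonal b) (w : Λ.words) :
    b (Λ.e w) = Λ.diagCoeff b w • Λ.e w := by
  ext v
  rw [hb, lp.coeFn_smul, Pi.smul_apply, smul_eq_mul]
  classical
  by_cases h : v = w
  · rw [h]
  · have : (v : MultiWord N d) ≠ w := fun h' => h (Subtype.ext h')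
    simp [e_apply, this]

variable (Λ)

/-- The factor `1` is kept so that the formula has the shape expected by `diagCoeff_eq`. -/
theorem one_apply_coord (f : Λ.H) (w : Λ.words) : (1 : Λ.B) f w = 1 * f w := (one_mul _).symm

theorem add_apply_coord (a b : Λ.B) (f : Λ.H) (w : Λ.words) : (a + b) f w = a f w + b f w := rfl

theorem mul_apply_coord (a b : Λ.B) (f : Λ.H) (w : Λ.words) : (a * b) f w = a (b f) w := rfl

theorem algebraMap_apply_coord (r : ℂ) (f : Λ.H) (w : Λ.words) :
    (algebraMap ℂ Λ.B r) f w = r * f w := by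
  rw [Algebra.algebraMap_eq_smul_one]
  rfl

variable {Λ}

theorem IsDiagonal.add_apply {a b : Λ.B} (ha : Λ.IsDiagonal a) (hb : Λ.IsDiagonal b)
    (f : Λ.H) (w : Λ.words) :
    (a + b) f w = (Λ.diagCoeff a w + Λ.diagCoeff b w) * f w := by
  rw [add_apply_coord, ha, hb, add_mul]

theorem IsDiagonal.mul_apply {a b : Λ.B} (ha : Λ.IsDiagonal a) (hb : Λ.IsDiagonal b)
    (f : Λ.H) (w : Λ.words) :
    (a * b) f w = (Λ.diagCoeff a w * Λ.diagCoeff b w) * f w := by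
  rw [mul_apply_coord, ha, hb, mul_assoc]

/-- Each `e_w` is an eigenvector of `a`, so moving `a` across the inner product conjugates its
entry. -/
theorem IsDiagonal.star_apply {a : Λ.B} (ha : Λ.IsDiagonal a) (f : Λ.H) (w : Λ.words) :
    (star a) f w = star (Λ.diagCoeff a w) * f w := by
  rw [← Λ.inner_e w.2, ContinuousLinearMap.star_eq_adjoint,
    ContinuousLinearMap.adjoint_inner_right, ha.apply_e, inner_smul_left, Λ.inner_e w.2]
  rfl

variable (Λ)

theorem isClosed_isDiagonal : IsClosed {b : Λ.B | Λ.IsDiagonal b} := by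
  have hc : ∀ (f : Λ.H) (w : Λ.words), Continuous fun b : Λ.B => b f w := by
    intro f w
    have : Continuous fun b : Λ.B => inner ℂ (Λ.e w) (b f) := by fun_prop
    simpa only [Λ.inner_e w.2] using this
  simp only [IsDiagonal, Set.ofPred_forall]
  refine isClosed_iInter fun f => isClosed_iInter fun w => ?_
  exact isClosed_eq (hc f w) ((hc _ w).mul continuous_const)

theorem continuous_diagCoeff (w : Λ.words) : Continuous fun b : Λ.B => Λ.diagCoeff b w := by
  have : Continuous fun b : Λ.B => inner ℂ (Λ.e w) (b (Λ.e w)) := by fun_prop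
  simpa only [Λ.inner_e w.2, diagCoeff] using this

/-- The diagonal operators whose entries at `u` and `v` agree. -/
def diagonalEq (u v : Λ.words) : StarSubalgebra ℂ Λ.B where
  carrier := {b | Λ.IsDiagonal b ∧ Λ.diagCoeff b u = Λ.diagCoeff b v}
  mul_mem' := by
    rintro a b ⟨ha, ha'⟩ ⟨hb, hb'⟩
    have h := ha.mul_apply hb
    exact ⟨isDiagonal_of_forall h, by rw [diagCoeff_eq h, diagCoeff_eq h, ha', hb']⟩
  add_mem' := by
    rintro a b ⟨ha, ha'⟩ ⟨hb, hb'⟩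
    have h := ha.add_apply hb
    exact ⟨isDiagonal_of_forall h, by rw [diagCoeff_eq h, diagCoeff_eq h, ha', hb']⟩
  algebraMap_mem' r := by
    have h := Λ.algebraMap_apply_coord r
    exact ⟨isDiagonal_of_forall (c := fun _ => r) h,
      by rw [diagCoeff_eq (c := fun _ => r) h, diagCoeff_eq (c := fun _ => r) h]⟩
  star_mem' := by
    rintro a ⟨ha, ha'⟩
    have h := ha.star_apply
    exact ⟨isDiagonal_of_forall h, by rw [diagCoeff_eq h, diagCoeff_eq h, ha']⟩

/-! ### Coordinates of `T_μ` and entries of elements of `A`. -/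

theorem pull_e (μ : MultiWord N d) {w : MultiWord N d} (h : μ * w ∈ Λ.words) :
    Λ.pull μ (Λ.e (μ * w)) = Λ.e w := by
  classical
  ext v
  rw [pull_apply, pullFun, e_apply]
  by_cases hv : (v : MultiWord N d) = w
  · simp [hv, h, e_apply]
  · simp [hv, e_apply]

theorem pull_e_eq_zero {μ w : MultiWord N d} (h : ∀ v, w ≠ μ * v) : Λ.pull μ (Λ.e w) = 0 := by
  classical
  ext v
  rw [pull_apply, pullFun]
  split_ifs with h'
  · simp [e_apply, (h v).symm]
  · rfl

theorem T_apply_mul (μ : MultiWord N d) (f : Λ.H) {w : MultiWord N d} (h : μ * w ∈ Λ.words) :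
    Λ.T μ f ⟨μ * w, h⟩ = f ⟨w, Λ.mem_of_mul_mem_right h⟩ := by
  rw [← Λ.inner_e h, T, ContinuousLinearMap.adjoint_inner_right, pull_e _ _ h,
    Λ.inner_e (Λ.mem_of_mul_mem_right h)]

theorem T_apply_eq_zero {μ : MultiWord N d} (f : Λ.H) {w : Λ.words}
    (h : ∀ v, (w : MultiWord N d) ≠ μ * v) : Λ.T μ f w = 0 := by
  rw [← Λ.inner_e w.2, T, ContinuousLinearMap.adjoint_inner_right, pull_e_eq_zero _ h,
    inner_zero_left]

open Classical in
theorem star_T_mul_T_apply (μ : MultiWord N d) (f : Λ.H) (w : Λ.words) :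
    (star (Λ.T μ) * Λ.T μ) f w = (if μ * (w : MultiWord N d) ∈ Λ.words then 1 else 0) * f w := by
  rw [mul_apply_coord, star_T, pull_apply, pullFun]
  split_ifs with h
  · rw [T_apply_mul, one_mul]
  · rw [zero_mul]

/-- The hypothesis says that no generator distinguishes `u` from `v`. Since `diagonalEq u v` is a
norm-closed star subalgebra, nothing in `A` does either. -/
theorem A_le_diagonalEq {u v : Λ.words}
    (h : ∀ μ ∈ Λ.words, μ * (u : MultiWord N d) ∈ Λ.words ↔ μ * (v : MultiWord N d) ∈ Λ.words) :
    Λ.A ≤ Λ.diagonalEq u v := by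
  classical
  refine StarSubalgebra.topologicalClosure_minimal (StarAlgebra.adjoin_le ?_) ?_
  · rintro _ ⟨μ, hμ, rfl⟩
    have h' := Λ.star_T_mul_T_apply μ
    refine ⟨isDiagonal_of_forall h', ?_⟩
    rw [diagCoeff_eq h', diagCoeff_eq h']
    simp only [h μ hμ]
  · exact Λ.isClosed_isDiagonal.inter
      (isClosed_eq (Λ.continuous_diagCoeff u) (Λ.continuous_diagCoeff v))

variable {Λ}

theorem isDiagonal_of_mem_A {a : Λ.B} (ha : a ∈ Λ.A) : Λ.IsDiagonal a := by
  intro f w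
  -- With `u = v` the condition on entries is vacuous and only diagonality remains.
  exact (Λ.A_le_diagonalEq (u := w) (v := w) (fun _ _ => Iff.rfl) ha).1 f w

/-! ### The projections `P_i`, `Q_F` and `Q_∅` in coordinates. -/

variable (Λ)

-- A word with nonempty coordinate `i` has exactly one first letter there, so exactly one summand of
-- `P_i` fixes its coordinate and the others annihilate it.
open Classical in
theorem P_apply (i : Fin N) (f : Λ.H) (w : Λ.words) :
    Λ.P i f w = if (w : MultiWord N d) i = 1 then 0 else f w := by
  have hsum : Λ.P i f w = ∑ k, (Λ.T (delta i k) * star (Λ.T (delta i k))) f w := by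
    rw [← Λ.inner_e w.2, P, _root_.sum_apply, inner_sum]
    simp only [Λ.inner_e w.2]
  rw [hsum]
  split_ifs with h
  · refine Finset.sum_eq_zero fun k _ => ?_
    rw [mul_apply_coord]
    refine Λ.T_apply_eq_zero _ fun v hv => delta_mul_apply_ne_one i k v ?_
    rw [← hv, h]
  · obtain ⟨k, v, hv⟩ := exists_eq_delta_mul h
    obtain ⟨w, hw⟩ := w
    subst hv
    rw [Finset.sum_eq_single k]
    · rw [mul_apply_coord, T_apply_mul, star_T, pull_apply, pullFun, dif_pos hw]
    · intro l _ hl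
      rw [mul_apply_coord]
      exact Λ.T_apply_eq_zero _ fun v' hv' => hl (delta_mul_inj hv').symm
    · simp

open Classical in
theorem Q_apply (F : Finset (Fin N)) (f : Λ.H) (w : Λ.words) :
    Λ.Q F f w = if ∀ i ∈ F, (w : MultiWord N d) i = 1 then f w else 0 := by
  have key : ∀ l : List (Fin N), (l.map fun i => 1 - Λ.P i).prod f w =
      if ∀ i ∈ l, (w : MultiWord N d) i = 1 then f w else 0 := by
    intro l
    induction l with
    | nil => simp
    | cons i l ih =>
      have hsub : ∀ g : Λ.H, (1 - Λ.P i) g w = g w - Λ.P i g w := fun g => rfl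
      rw [List.map_cons, List.prod_cons, mul_apply_coord, hsub, P_apply, ih]
      by_cases h : (w : MultiWord N d) i = 1 <;> simp [h]
  rw [Q, key]
  simp

theorem Q_empty : Λ.Q ∅ = 1 := by
  simp [Q]

open Classical in
theorem QEmptyWord_apply (f : Λ.H) (w : Λ.words) :
    Λ.QEmptyWord f w = (if (w : MultiWord N d) = 1 then 1 else 0) * f w := by
  have h1 : (1 : MultiWord N d) ∈ Λ.words := Λ.subword_mem _ w.2 1 ⟨1, w, by simp⟩
  have hn : ‖Λ.e 1‖ = 1 := by
    rw [e, dif_pos h1, lp.norm_single (by norm_num)]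
    simp
  rw [QEmptyWord, Submodule.starProjection_unit_singleton ℂ hn, Λ.inner_e h1, lp.coeFn_smul,
    Pi.smul_apply, smul_eq_mul, e_apply]
  by_cases h : (w : MultiWord N d) = 1
  · have : w = ⟨1, h1⟩ := Subtype.ext h
    subst this
    simp
  · simp [h]

theorem QEmptyWord_ne_zero (h : (1 : MultiWord N d) ∈ Λ.words) : Λ.QEmptyWord ≠ 0 := by
  intro h0
  have := Λ.QEmptyWord_apply (Λ.e 1) ⟨1, h⟩
  rw [h0, Λ.e_self ⟨1, h⟩] at this
  simp at this

/-! ### Kernels of the left actions. -/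

/-- The range of `T_{δ_i(k)}` is carried by words whose coordinate `i` starts with `k`, and these
operators generate `X_i` as a closed right module; so `φ_i(a) = 0` only tests the entries of `a` at
such words. -/
theorem mem_ker_phi_iff (i : Fin N) (a : Λ.A) :
    a ∈ RingHom.ker (Λ.phi i) ↔
      ∀ w : Λ.words, (w : MultiWord N d) i ≠ 1 → Λ.diagCoeff a w = 0 := by
  have hd := isDiagonal_of_mem_A a.2
  rw [RingHom.mem_ker]
  constructor
  · rintro h ⟨w, hw⟩ hwi
    obtain ⟨k, v, rfl⟩ := exists_eq_delta_mul hwi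
    have hξ : Λ.T (delta i k) ∈ Λ.X i :=
      Submodule.le_topologicalClosure _ (Submodule.subset_span
        ⟨k, Λ.mem_of_mul_mem_left hw, 1, OneMemClass.one_mem _, (mul_one _).symm⟩)
    have h0 : (a : Λ.B) * Λ.T (delta i k) = 0 := by
      rw [← Λ.coe_phi_apply i a ⟨_, hξ⟩, h]
      rfl
    rw [diagCoeff, ← Λ.T_e _ (Λ.mem_of_mul_mem_right hw), ← mul_apply_coord, h0]
    rfl
  · intro h
    have hT : ∀ k, (a : Λ.B) * Λ.T (delta i k) = 0 := by
      intro k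
      ext f w
      rw [mul_apply_coord, hd]
      by_cases hw : (w : MultiWord N d) i = 1
      · rw [Λ.T_apply_eq_zero f fun v hv => delta_mul_apply_ne_one i k v (by rw [← hv, hw]),
          mul_zero]
        rfl
      · rw [h w hw, zero_mul]
        rfl
    have hcl : IsClosed {ξ : Λ.B | (a : Λ.B) * ξ = 0} :=
      isClosed_eq (continuous_const.mul continuous_id) continuous_const
    refine ContinuousLinearMap.ext fun ξ => Subtype.ext ?_
    rw [coe_phi_apply]
    refine closure_minimal (t := {ξ : Λ.B | (a : Λ.B) * ξ = 0}) ?_ hcl ξ.2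
    intro ζ hζ
    rw [Set.mem_ofPred_eq]
    induction hζ using Submodule.span_induction with
    | mem x hx =>
      obtain ⟨k, -, b, -, rfl⟩ := hx
      rw [← mul_assoc, hT, zero_mul]
    | zero => rw [mul_zero]
    | add x y _ _ hx hy => rw [mul_add, hx, hy, add_zero]
    | smul r x _ hx => rw [mul_smul_comm, hx, smul_zero]

theorem mem_kerPhi_iff (F : Finset (Fin N)) (a : Λ.A) :
    a ∈ Λ.kerPhi F ↔
      ∀ i ∈ F, ∀ w : Λ.words, (w : MultiWord N d) i ≠ 1 → Λ.diagCoeff a w = 0 := by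
  simp only [kerPhi, Submodule.mem_iInf, mem_ker_phi_iff]

variable {Λ}

theorem diagCoeff_one_ne_zero_of_mem_kerPhi {F : Finset (Fin N)} {a : Λ.A}
    (ha : a ∈ Λ.kerPhi F) (hQ : (a : Λ.B) * Λ.Q Fᶜ ≠ 0) (h1 : (1 : MultiWord N d) ∈ Λ.words) :
    Λ.diagCoeff a ⟨1, h1⟩ ≠ 0 := by
  classical
  intro h0
  apply hQ
  ext f w
  rw [mul_apply_coord, isDiagonal_of_mem_A a.2, Q_apply]
  split_ifs with h
  · suffices Λ.diagCoeff a w = 0 by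
      rw [this, zero_mul]
      rfl
    by_cases hw : w = ⟨1, h1⟩
    · rw [hw, h0]
    · obtain ⟨i, hi⟩ : ∃ i, (w : MultiWord N d) i ≠ 1 := by
        by_contra! hall
        exact hw (Subtype.ext (funext hall))
      refine (Λ.mem_kerPhi_iff F a).1 ha i ?_ w hi
      by_contra hiF
      exact hi (h i (Finset.mem_compl.2 hiF))
  · rw [mul_zero]
    rfl

/-- If some entry of `a ∈ A` at a generator differs from its entry at the empty word, then the
generator can be prolonged to the left to a forbidden word. -/
theorem exists_mul_notMem {a : Λ.B} (ha : a ∈ Λ.A) (h1 : (1 : MultiWord N d) ∈ Λ.words)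
    {v : MultiWord N d} (hv : v ∈ Λ.words)
    (hne : Λ.diagCoeff a ⟨1, h1⟩ ≠ Λ.diagCoeff a ⟨v, hv⟩) :
    ∃ μ ∈ Λ.words, μ * v ∉ Λ.words := by
  -- Otherwise `μ` and `μ * v` are both allowed for every `μ ∈ Λ*`, so no generator separates the
  -- empty word from `v`.
  by_contra! h
  refine hne (Λ.A_le_diagonalEq (u := ⟨1, h1⟩) (v := ⟨v, hv⟩) (fun μ hμ => ?_) ha).2
  simp [hμ, h μ hμ]

theorem diagCoeff_one (w : Λ.words) : Λ.diagCoeff 1 w = 1 :=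
  diagCoeff_eq (c := fun _ => 1) (Λ.one_apply_coord) w

theorem diagCoeff_mul {a b : Λ.B} (ha : a ∈ Λ.A) (hb : b ∈ Λ.A) (w : Λ.words) :
    Λ.diagCoeff (a * b) w = Λ.diagCoeff a w * Λ.diagCoeff b w :=
  diagCoeff_eq ((isDiagonal_of_mem_A ha).mul_apply (isDiagonal_of_mem_A hb)) w

/-- Finitely many words, each with a forbidden left prolongation, are separated from the empty word
by an element of `A`. -/
theorem exists_separating (h1 : (1 : MultiWord N d) ∈ Λ.words) {ι : Type*} (s : Finset ι)
    (v : ι → MultiWord N d) (h : ∀ j ∈ s, ∃ μ ∈ Λ.words, μ * v j ∉ Λ.words) :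
    ∃ a : Λ.A, Λ.diagCoeff a ⟨1, h1⟩ = 1 ∧
      ∀ j ∈ s, ∀ w : Λ.words, (∃ q, (w : MultiWord N d) = v j * q) → Λ.diagCoeff a w = 0 := by
  classical
  induction s using Finset.induction_on with
  | empty => exact ⟨1, diagCoeff_one _, by simp⟩
  | insert j s hj ih =>
    obtain ⟨a, ha1, ha⟩ := ih fun l hl => h l (Finset.mem_insert_of_mem hl)
    obtain ⟨μ, hμ, hμj⟩ := h j (Finset.mem_insert_self j s)
    have hc := diagCoeff_eq (Λ.star_T_mul_T_apply μ)
    -- The new factor has entry 1 at the empty word because `μ` is allowed, and entry 0 at every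
    -- word starting with `v j` because `μ * v j` is forbidden.
    refine ⟨⟨_, Λ.gen_mem_A μ⟩ * a, ?_, ?_⟩
    · rw [MulMemClass.coe_mul, diagCoeff_mul (Λ.gen_mem_A μ) a.2, ha1, hc]
      simp [hμ]
    · rintro l hl w ⟨q, hq⟩
      rw [MulMemClass.coe_mul, diagCoeff_mul (Λ.gen_mem_A μ) a.2]
      rcases Finset.mem_insert.1 hl with rfl | hl
      · rw [hc, if_neg, zero_mul]
        rw [hq, ← mul_assoc]
        exact fun h' => hμj (Λ.mem_of_mul_mem_left h')
      · rw [ha l hl w ⟨q, hq⟩, mul_zero]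

/-- Any allowed word with nonempty coordinate `i` starts with one of the finitely many allowed
`δ_i(k)`, so separating these from the empty word suffices. -/
theorem exists_mem_kerPhi {F : Finset (Fin N)} (h1 : (1 : MultiWord N d) ∈ Λ.words)
    (h : ∀ (i : Fin N) (k : Fin d), i ∈ F → MultiWord.delta i k ∈ Λ.words →
      ∃ μ ∈ Λ.words, μ * MultiWord.delta i k ∉ Λ.words) :
    ∃ a ∈ Λ.kerPhi F, Λ.diagCoeff a ⟨1, h1⟩ = 1 := by
  classical
  obtain ⟨a, ha1, ha⟩ := exists_separating h1
    ((F ×ˢ Finset.univ).filter fun p : Fin N × Fin d => delta p.1 p.2 ∈ Λ.words)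
    (fun p => delta p.1 p.2) (by
      rintro ⟨i, k⟩ hp
      rw [Finset.mem_filter, Finset.mem_product] at hp
      exact h i k hp.1.1 hp.2)
  refine ⟨a, (Λ.mem_kerPhi_iff F a).2 fun i hi w hw => ?_, ha1⟩
  obtain ⟨k, v, hv⟩ := exists_eq_delta_mul hw
  refine ha (i, k) ?_ w ⟨v, hv⟩
  rw [Finset.mem_filter, Finset.mem_product]
  exact ⟨⟨hi, Finset.mem_univ _⟩, Λ.mem_of_mul_mem_left (hv ▸ w.2)⟩

/-- A nonempty word either has a letter outside `F`, and is killed by `Q_{F^c}`, or has one inside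
`F`, where the entry of `a` vanishes. -/
theorem mul_Q_eq_smul_QEmptyWord {F : Finset (Fin N)} {a : Λ.A} (ha : a ∈ Λ.kerPhi F)
    (h1 : (1 : MultiWord N d) ∈ Λ.words) :
    (a : Λ.B) * Λ.Q Fᶜ = Λ.diagCoeff a ⟨1, h1⟩ • Λ.QEmptyWord := by
  classical
  ext f w
  have hs : (Λ.diagCoeff a ⟨1, h1⟩ • Λ.QEmptyWord) f w =
      Λ.diagCoeff a ⟨1, h1⟩ * Λ.QEmptyWord f w := rfl
  rw [hs, QEmptyWord_apply, mul_apply_coord, isDiagonal_of_mem_A a.2, Q_apply]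
  by_cases hw : w = ⟨1, h1⟩
  · subst hw
    simp
  · have hw' : (w : MultiWord N d) ≠ 1 := fun h => hw (Subtype.ext h)
    rw [if_neg hw', zero_mul, mul_zero]
    split_ifs with h
    · obtain ⟨i, hi⟩ : ∃ i, (w : MultiWord N d) i ≠ 1 := by
        by_contra! hall
        exact hw' (funext hall)
      rw [(Λ.mem_kerPhi_iff F a).1 ha i (by
        by_contra hiF
        exact hi (h i (Finset.mem_compl.2 hiF))) w hi, zero_mul]
    · rw [mul_zero]

theorem diagCoeff_mul_Q {F : Finset (Fin N)} {a : Λ.B} (ha : a ∈ Λ.A) {w : Λ.words}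
    (hw : ∀ i ∉ F, (w : MultiWord N d) i = 1) :
    Λ.diagCoeff (a * Λ.Q Fᶜ) w = Λ.diagCoeff a w := by
  classical
  rw [diagCoeff, mul_apply_coord, isDiagonal_of_mem_A ha, Q_apply, if_pos, e_self, mul_one]
  exact fun i hi => hw i (Finset.mem_compl.1 hi)

theorem diagCoeff_QEmptyWord (w : Λ.words) [Decidable ((w : MultiWord N d) = 1)] :
    Λ.diagCoeff Λ.QEmptyWord w = if (w : MultiWord N d) = 1 then 1 else 0 := by
  rw [diagCoeff_eq Λ.QEmptyWord_apply]
  congr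

end FactorialLanguage

/-! ### The equivalences. -/

open FactorialLanguage in
theorem proposition8 {N d : ℕ} (Λ : FactorialLanguage N d) (F : Finset (Fin N))
    (hF : F.Nonempty) :
    List.TFAE [
      ∃ a ∈ Λ.kerPhi F, (a : Λ.B) * Λ.Q Fᶜ ≠ 0,
      ∃ a : Λ.A, (a : Λ.B) * Λ.Q Fᶜ = Λ.QEmptyWord,
      ∀ (i : Fin N) (k : Fin d), i ∈ F → MultiWord.delta i k ∈ Λ.words →
        ∃ μ ∈ Λ.words, μ * MultiWord.delta i k ∉ Λ.words] ∧
    (F = Finset.univ →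
      List.TFAE [
        ∀ (i : Fin N) (k : Fin d), i ∈ F → MultiWord.delta i k ∈ Λ.words →
          ∃ μ ∈ Λ.words, μ * MultiWord.delta i k ∉ Λ.words,
        (fun a : Λ.A => (a : Λ.B)) '' (Λ.kerPhi Finset.univ : Set Λ.A) =
          {b : Λ.B | ∃ c : ℂ, b = c • Λ.QEmptyWord},
        Λ.kerPhi Finset.univ ≠ ⊥,
        Λ.QEmptyWord ∈ Λ.A]) := by
  classical
  -- A coordinate is needed to know that the empty word is allowed: for `N = 0` the language may be
  -- empty.
  obtain ⟨i₀, -⟩ := hF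
  have h1 := Λ.one_mem_words i₀
  have hδ : ∀ (i : Fin N) (k : Fin d), MultiWord.delta i k i ≠ 1 := fun i k => by
    simpa using MultiWord.delta_mul_apply_ne_one i k 1
  have hfirst : List.TFAE [
      ∃ a ∈ Λ.kerPhi F, (a : Λ.B) * Λ.Q Fᶜ ≠ 0,
      ∃ a : Λ.A, (a : Λ.B) * Λ.Q Fᶜ = Λ.QEmptyWord,
      ∀ (i : Fin N) (k : Fin d), i ∈ F → MultiWord.delta i k ∈ Λ.words →
        ∃ μ ∈ Λ.words, μ * MultiWord.delta i k ∉ Λ.words] := by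
    tfae_have 1 → 3 := by
      rintro ⟨a, ha, hQ⟩ i k hi hk
      refine exists_mul_notMem a.2 h1 hk ?_
      rw [(Λ.mem_kerPhi_iff F a).1 ha i hi ⟨_, hk⟩ (hδ i k)]
      exact diagCoeff_one_ne_zero_of_mem_kerPhi ha hQ h1
    tfae_have 2 → 3 := by
      rintro ⟨a, ha⟩ i k hi hk
      refine exists_mul_notMem a.2 h1 hk ?_
      -- Both the empty word and `δ_i(k)` are supported on `F`, so the entries of `a` there can be
      -- read off from `a Q_{F^c} = Q_∅`: they are 1 and 0.
      rw [← diagCoeff_mul_Q (F := F) a.2 fun _ _ => rfl,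
        ← diagCoeff_mul_Q (F := F) (w := ⟨_, hk⟩) a.2 fun j hj => ?_, ha,
        diagCoeff_QEmptyWord, diagCoeff_QEmptyWord, if_pos rfl, if_neg]
      · exact one_ne_zero
      · exact fun h => hδ i k (congrFun h i)
      · exact Pi.mulSingle_eq_of_ne (fun h : j = i => hj (h ▸ hi)) _
    tfae_have 3 → 2 := by
      intro h
      obtain ⟨a, ha, ha1⟩ := exists_mem_kerPhi h1 h
      exact ⟨a, by rw [mul_Q_eq_smul_QEmptyWord ha h1, ha1, one_smul]⟩
    tfae_have 3 → 1 := by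
      intro h
      obtain ⟨a, ha, ha1⟩ := exists_mem_kerPhi h1 h
      refine ⟨a, ha, ?_⟩
      rw [mul_Q_eq_smul_QEmptyWord ha h1, ha1, one_smul]
      exact Λ.QEmptyWord_ne_zero h1
    tfae_finish
  refine ⟨hfirst, ?_⟩
  rintro rfl
  -- For `F = [N]` the factor `Q_{F^c}` is the identity, so (i) and (ii) turn into (v) and (vi).
  rw [Finset.compl_univ, Q_empty] at hfirst
  simp only [mul_one] at hfirst
  have hker : ∀ a ∈ Λ.kerPhi Finset.univ,
      (a : Λ.B) = Λ.diagCoeff a ⟨1, h1⟩ • Λ.QEmptyWord := by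
    intro a ha
    have := mul_Q_eq_smul_QEmptyWord ha h1
    rwa [Finset.compl_univ, Q_empty, mul_one] at this
  have hmem : ∀ h : Λ.QEmptyWord ∈ Λ.A,
      (⟨Λ.QEmptyWord, h⟩ : Λ.A) ∈ Λ.kerPhi Finset.univ := by
    refine fun h => (Λ.mem_kerPhi_iff _ _).2 fun i _ w hw => ?_
    rw [diagCoeff_QEmptyWord, if_neg fun h' => hw (by rw [h', Pi.one_apply])]
  tfae_have 1 → 4 := by
    intro h
    obtain ⟨a, ha⟩ := (hfirst.out 2 1).1 h
    exact ha ▸ a.2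
  tfae_have 4 → 2 := by
    intro h
    ext b
    constructor
    · rintro ⟨a, ha, rfl⟩
      exact ⟨_, hker a ha⟩
    · rintro ⟨c, rfl⟩
      refine ⟨algebraMap ℂ Λ.A c * ⟨_, h⟩, Ideal.mul_mem_left _ _ (hmem h), ?_⟩
      exact (Algebra.smul_def c Λ.QEmptyWord).symm
  tfae_have 2 → 3 := by
    intro h hbot
    have : Λ.QEmptyWord ∈ {b : Λ.B | ∃ c : ℂ, b = c • Λ.QEmptyWord} :=
      ⟨1, (one_smul _ _).symm⟩
    rw [← h, hbot] at this
    obtain ⟨a, ha, ha'⟩ := this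
    have ha0 : a = 0 := ha
    subst ha0
    exact Λ.QEmptyWord_ne_zero h1 ha'.symm
  tfae_have 3 → 1 := by
    intro h
    obtain ⟨a, ha, ha0⟩ := Submodule.exists_mem_ne_zero_of_ne_bot h
    refine (hfirst.out 0 2).1 ?_
    exact ⟨a, ha, fun h0 => ha0 (Subtype.ext h0)⟩
  tfae_finish
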